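/- Let $n\ge 3$, let $\varepsilon_1,\dots,\varepsilon_n\in\{1,-1\}$, and let $(\mathbb R^n,g)$ be the pseudo-Euclidean space with $g_{ij}=\delta_{ij}\varepsilon_i$. Let $\alpha_1,\dots,\alpha_n\in\mathbb R$ with $\varepsilon_0:=\sum_{i}\varepsilon_i\alpha_i^2\neq 0$, and put $\xi=\sum_i\alpha_i x_i$. Let $(F^m,g_F)$ be a Ricci-flat semi-Riemannian manifold of dimension $m$, and let $\varphi:\mathbb R\to(0,\infty)$ be any smooth function. Set $f=1/\varphi$ and, for arbitrary constants $a,b,c,k\in\mathbb R$ (where $a,b$ are base points of the integrals), $$h(\xi)=c+k\int_b^{\xi}\frac{ds}{\varphi(s)^2}-(m+n-2)\int_b^{\xi}\Big[\int_a^{s}\varphi(r)\varphi''(r)\,dr\Big]\frac{ds}{\varphi(s)^2},$$ $$\rho(\xi)=\varepsilon_0\Big\{\varphi\varphi''-(m+n-1)(\varphi')^2-k\frac{\varphi'}{\varphi}+(m+n-2)\frac{\varphi'}{\varphi}\int_a^{\xi}\varphi(r)\varphi''(r)\,dr\Big\}.$$ Let $M=(\mathbb R^n,\bar g)\times_f F^m$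 be the warped product with $\bar g=\varphi(\xi)^{-2}g$ and warping function $f(\xi)$, i.e. the product manifold $\mathbb R^n\times F$ with $\tilde g=\bar g+f(\xi)^2g_F$. Then $\tilde g=\varphi(\xi)^{-2}(g+g_F)$, and $(M,\tilde g)$ is a gradient Ricci almost soliton with potential function $h(\xi)$ and soliton function $\rho(\xi)$: $\tilde g$ is a semi-Riemannian metric, $h(\xi)$ and $\rho(\xi)$ are smooth on $M$ (they depend only on the $\mathbb R^n$ factor), and $$\mathrm{Ric}_{\tilde g}+\mathrm{Hess}_{\tilde g}(h)=\rho\,\tilde g .$$ -/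

import Mathlib

set_option maxSynthPendingDepth 3

open scoped Manifold ContDiff

noncomputable section

namespace SemiRiem

/-! ### Semi-Riemannian geometry in local coordinates

`G : E → E →L[ℝ] E →L[ℝ] ℝ` is a metric given in coordinates: `G y u v = g_y(u, v)`. -/

section Local

variable {E : Type*} [NormedAddCommGroup E] [NormedSpace ℝ E]

/-- Christoffel symbols of the first kind:
`Γ♭_y(u, v)(w) = ½ (∂_u G(v, w) + ∂_v G(u, w) - ∂_w G(u, v))`. -/
def christoffelFirst (G : E → E →L[ℝ] E →L[ℝ] ℝ) (y : E) :
    E →L[ℝ] E →L[ℝ] E →L[ℝ] ℝ :=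
  (1 / 2 : ℝ) • (fderiv ℝ G y + (fderiv ℝ G y).flip -
    ((ContinuousLinearMap.flipₗᵢ ℝ E E ℝ).toContinuousLinearEquiv :
      (E →L[ℝ] E →L[ℝ] ℝ) →L[ℝ] (E →L[ℝ] E →L[ℝ] ℝ)).comp (fderiv ℝ G y).flip)

theorem christoffelFirst_apply (G : E → E →L[ℝ] E →L[ℝ] ℝ) (y u v w : E) :
    christoffelFirst G y u v w =
      (1 / 2 : ℝ) * (fderiv ℝ G y u v w + fderiv ℝ G y v u w - fderiv ℝ G y w u v) := by
  simp [christoffelFirst]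

/-- Christoffel symbols (of the second kind) as a bilinear map, with the index raised by the
inverse of the metric `G y : E →L[ℝ] (E →L[ℝ] ℝ)`. -/
def christoffel (G : E → E →L[ℝ] E →L[ℝ] ℝ) (y : E) : E →L[ℝ] E →L[ℝ] E :=
  (ContinuousLinearMap.compL ℝ E (E →L[ℝ] ℝ) E (G y).inverse).comp (christoffelFirst G y)

theorem christoffel_apply (G : E → E →L[ℝ] E →L[ℝ] ℝ) (y u v : E) :
    christoffel G y u v = (G y).inverse (christoffelFirst G y u v) := rfl

/-- The endomorphism `u ↦ R(u, v) w` of the curvature tensor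
`R(u, v) w = ∇_u ∇_v w - ∇_v ∇_u w` (constant vector fields `u`, `v`, `w`). -/
def curvature (G : E → E →L[ℝ] E →L[ℝ] ℝ) (y v w : E) : E →L[ℝ] E :=
  ((fderiv ℝ (christoffel G) y).flip v).flip w - (fderiv ℝ (christoffel G) y v).flip w
    + (christoffel G y).flip (christoffel G y v w)
    - (christoffel G y v).comp ((christoffel G y).flip w)

theorem curvature_apply (G : E → E →L[ℝ] E →L[ℝ] ℝ) (y u v w : E) :
    curvature G y v w u =
      fderiv ℝ (christoffel G) y u v w - fderiv ℝ (christoffel G) y v u w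
        + christoffel G y u (christoffel G y v w)
        - christoffel G y v (christoffel G y u w) := by
  simp [curvature]

/-- Ricci curvature in coordinates: `Ric(v, w) = tr (u ↦ R(u, v) w)`. -/
def ricciLocal (G : E → E →L[ℝ] E →L[ℝ] ℝ) (y v w : E) : ℝ :=
  LinearMap.trace ℝ E (curvature G y v w : E →ₗ[ℝ] E)

/-- Hessian in coordinates: `Hess h (u, v) = ∂_u ∂_v h - dh(Γ(u, v))`. -/
def hessLocal (G : E → E →L[ℝ] E →L[ℝ] ℝ) (h : E → ℝ) (y u v : E) : ℝ :=
  fderiv ℝ (fderiv ℝ h) y u v - fderiv ℝ h y (christoffel G y u v)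

end Local

/-! ### Semi-Riemannian metrics on (boundaryless) manifolds -/

section Global

variable {E : Type*} [NormedAddCommGroup E] [NormedSpace ℝ E] {H : Type*} [TopologicalSpace H]
  (I : ModelWithCorners ℝ E H) (M : Type*) [TopologicalSpace M] [ChartedSpace H M]

/-- A field of bilinear forms on the tangent spaces of `M` (a `(0,2)`-tensor field). -/
abbrev BilinField : Type _ :=
  (x : M) → TangentSpace I x →L[ℝ] TangentSpace I x →L[ℝ] ℝ

variable {I M}

/-- The expression of `g` in the preferred chart at `x₀`: the pullback of `g` by the inverse of
that chart. -/
def BilinField.inChart (g : BilinField I M) (x₀ : M) (y : E) : E →L[ℝ] E →L[ℝ] ℝ :=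
  let B : E →L[ℝ] E →L[ℝ] ℝ := g ((extChartAt I x₀).symm y)
  let A : E →L[ℝ] E := mfderiv 𝓘(ℝ, E) I (extChartAt I x₀).symm y
  B.bilinearComp A A

theorem BilinField.inChart_apply (g : BilinField I M) (x₀ : M) (y u v : E) :
    g.inChart x₀ y u v = g ((extChartAt I x₀).symm y)
      (mfderiv 𝓘(ℝ, E) I (extChartAt I x₀).symm y u)
      (mfderiv 𝓘(ℝ, E) I (extChartAt I x₀).symm y v) := rfl

/-- `g` is a semi-Riemannian metric: a smooth symmetric nondegenerate `(0,2)`-tensor field of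
constant index. -/
structure IsSemiRiemannian (g : BilinField I M) : Prop where
  symm : ∀ (x : M) (u v : TangentSpace I x), g x u v = g x v u
  nondegenerate : ∀ (x : M) (u : TangentSpace I x), (∀ v : TangentSpace I x, g x u v = 0) → u = 0
  /-- Constant index. By Sylvester's law of inertia, two nondegenerate symmetric forms on spaces
  of the same finite dimension have the same index iff they are linearly isometric. -/
  constant_index : ∀ x y : M, ∃ T : TangentSpace I x ≃L[ℝ] TangentSpace I y,
    ∀ u v : TangentSpace I x, g y (T u) (T v) = g x u v
  /-- The components of `g` in the charts of an atlas are smooth. -/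
  smooth : ∀ x₀ : M, ContDiffOn ℝ ∞ (g.inChart x₀) (extChartAt I x₀).target

/-- The Ricci tensor of `g` at `x`, computed in the preferred chart at `x`. -/
def ricci (g : BilinField I M) (x : M) (u v : TangentSpace I x) : ℝ :=
  ricciLocal (g.inChart x) (extChartAt I x x)
    (mfderiv I 𝓘(ℝ, E) (extChartAt I x) x u) (mfderiv I 𝓘(ℝ, E) (extChartAt I x) x v)

/-- The Hessian of `h` with respect to `g` at `x`, computed in the preferred chart at `x`. -/
def hess (g : BilinField I M) (h : M → ℝ) (x : M) (u v : TangentSpace I x) : ℝ :=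
  hessLocal (g.inChart x) (h ∘ (extChartAt I x).symm) (extChartAt I x x)
    (mfderiv I 𝓘(ℝ, E) (extChartAt I x) x u) (mfderiv I 𝓘(ℝ, E) (extChartAt I x) x v)

/-- Ricci-flat metrics. -/
def IsRicciFlat (g : BilinField I M) : Prop :=
  ∀ (x : M) (u v : TangentSpace I x), ricci g x u v = 0

/-- `(M, g)` is a gradient Ricci almost soliton with potential function `h` and soliton function
`ρ`: `g` is a semi-Riemannian metric, `h` and `ρ` are smooth functions on `M`, and
`Ric_g + Hess_g h = ρ g`. -/
structure IsGradientRicciAlmostSoliton (g : BilinField I M) (h ρ : M → ℝ) : Prop where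
  metric : IsSemiRiemannian g
  smooth_potential : ContMDiff I 𝓘(ℝ, ℝ) ∞ h
  smooth_rho : ContMDiff I 𝓘(ℝ, ℝ) ∞ ρ
  equation : ∀ (x : M) (u v : TangentSpace I x),
    ricci g x u v + hess g h x u v = ρ x * g x u v

/-- The conformal metric `ψ⁻² g`. -/
def conformal (ψ : M → ℝ) (g : BilinField I M) : BilinField I M :=
  fun x => (1 / ψ x ^ 2) • g x

theorem conformal_apply (ψ : M → ℝ) (g : BilinField I M) (x : M) (u v : TangentSpace I x) :
    conformal ψ g x u v = 1 / ψ x ^ 2 * g x u v := rfl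

end Global

/-! ### Warped products -/

section Warped

variable {E : Type*} [NormedAddCommGroup E] [NormedSpace ℝ E] {H : Type*} [TopologicalSpace H]
  {I : ModelWithCorners ℝ E H} {B : Type*} [TopologicalSpace B] [ChartedSpace H B]
  {E' : Type*} [NormedAddCommGroup E'] [NormedSpace ℝ E'] {H' : Type*} [TopologicalSpace H']
  {J : ModelWithCorners ℝ E' H'} {F : Type*} [TopologicalSpace F] [ChartedSpace H' F]

/-- The warped product metric `g_B + f² g_F` on `B × F`. The tangent space of `B × F` at `p` is
the product of the tangent spaces of `B` at `p.1` and of `F` at `p.2`. -/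
def warpedProduct (gB : BilinField I B) (f : B → ℝ) (gF : BilinField J F) :
    BilinField (I.prod J) (B × F) := fun p =>
  let b : E →L[ℝ] E →L[ℝ] ℝ := gB p.1
  let c : E' →L[ℝ] E' →L[ℝ] ℝ := gF p.2
  let π₁ : E × E' →L[ℝ] E := ContinuousLinearMap.fst ℝ E E'
  let π₂ : E × E' →L[ℝ] E' := ContinuousLinearMap.snd ℝ E E'
  (b.bilinearComp π₁ π₁ + (f p.1 ^ 2) • c.bilinearComp π₂ π₂ : E × E' →L[ℝ] E × E' →L[ℝ] ℝ)

theorem warpedProduct_apply (gB : BilinField I B) (f : B → ℝ) (gF : BilinField J F) (p : B × F)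
    (u v : TangentSpace I p.1 × TangentSpace J p.2) :
    warpedProduct gB f gF p u v = gB p.1 u.1 v.1 + f p.1 ^ 2 * gF p.2 u.2 v.2 := rfl

end Warped

/-- The standard pseudo-Euclidean metric `g_{ij} = δ_{ij} ε_i` on `ℝⁿ`. -/
def pseudoEuclidean {n : ℕ} (ε : Fin n → ℝ) : BilinField (𝓡 n) (EuclideanSpace ℝ (Fin n)) :=
  fun _ =>
    (∑ i, ε i • (EuclideanSpace.proj i : EuclideanSpace ℝ (Fin n) →L[ℝ] ℝ).smulRight
      (EuclideanSpace.proj i : EuclideanSpace ℝ (Fin n) →L[ℝ] ℝ) :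
      EuclideanSpace ℝ (Fin n) →L[ℝ] EuclideanSpace ℝ (Fin n) →L[ℝ] ℝ)

theorem pseudoEuclidean_apply {n : ℕ} (ε : Fin n → ℝ) (x u v : EuclideanSpace ℝ (Fin n)) :
    pseudoEuclidean ε x u v = ∑ i, ε i * (u i * v i) := by
  let A : EuclideanSpace ℝ (Fin n) →L[ℝ] EuclideanSpace ℝ (Fin n) →L[ℝ] ℝ :=
    ∑ i, ε i • (EuclideanSpace.proj i : EuclideanSpace ℝ (Fin n) →L[ℝ] ℝ).smulRight
      (EuclideanSpace.proj i : EuclideanSpace ℝ (Fin n) →L[ℝ] ℝ)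
  change A u v = _
  simp [A]

end SemiRiem

end

noncomputable section

namespace SemiRiem

section LocalMetric

variable {E : Type*} [NormedAddCommGroup E] [NormedSpace ℝ E]

/-- `G` is a smooth symmetric nondegenerate bilinear form on the open set `U`. -/
structure IsMetricOn (G : E → E →L[ℝ] E →L[ℝ] ℝ) (U : Set E) : Prop where
  isOpen : IsOpen U
  smooth : ContDiffOn ℝ ∞ G U
  symm : ∀ y ∈ U, ∀ u v, G y u v = G y v u
  nondegenerate : ∀ y ∈ U, ∀ u, (∀ v, G y u v = 0) → u = 0

namespace IsMetricOn

variable {G : E → E →L[ℝ] E →L[ℝ] ℝ} {U : Set E} {y : E}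

theorem contDiffAt (hG : IsMetricOn G U) (hy : y ∈ U) : ContDiffAt ℝ ∞ G y :=
  hG.smooth.contDiffAt (hG.isOpen.mem_nhds hy)

theorem differentiableAt (hG : IsMetricOn G U) (hy : y ∈ U) : DifferentiableAt ℝ G y :=
  (hG.contDiffAt hy).differentiableAt (by simp)

theorem hasFDerivAt_apply (hG : IsMetricOn G U) (hy : y ∈ U) (u v : E) :
    HasFDerivAt (fun z => G z u v) (((fderiv ℝ G y).flip u).flip v) y := by
  have h := ((hG.differentiableAt hy).hasFDerivAt.clm_apply
    (hasFDerivAt_const u y)).clm_apply (hasFDerivAt_const v y)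
  refine h.congr_fderiv ?_
  ext w
  simp

theorem fderiv_apply (hG : IsMetricOn G U) (hy : y ∈ U) (u v w : E) :
    fderiv ℝ (fun z => G z u v) y w = fderiv ℝ G y w u v := by
  rw [(hG.hasFDerivAt_apply hy u v).fderiv]
  simp

theorem fderiv_symm (hG : IsMetricOn G U) (hy : y ∈ U) (u v w : E) :
    fderiv ℝ G y w u v = fderiv ℝ G y w v u := by
  rw [← hG.fderiv_apply hy, ← hG.fderiv_apply hy]
  have : (fun z => G z u v) =ᶠ[nhds y] fun z => G z v u := by
    filter_upwards [hG.isOpen.mem_nhds hy] with z hz using hG.symm z hz u v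
  rw [this.fderiv_eq]

theorem eq_of_forall_apply_eq (hG : IsMetricOn G U) (hy : y ∈ U) {u u' : E}
    (h : ∀ v, G y u v = G y u' v) : u = u' := by
  rw [← sub_eq_zero]
  apply hG.nondegenerate y hy
  intro v
  simp [h v]

theorem isInvertible [FiniteDimensional ℝ E] (hG : IsMetricOn G U) (hy : y ∈ U) :
    (G y).IsInvertible := by
  have hinj : Function.Injective (G y) := fun u u' h =>
    hG.eq_of_forall_apply_eq hy fun v => by rw [h]
  have e : (E →ₗ[ℝ] ℝ) ≃ₗ[ℝ] (E →L[ℝ] ℝ) := LinearMap.toContinuousLinearMap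
  have hdim : Module.finrank ℝ E = Module.finrank ℝ (E →L[ℝ] ℝ) := by
    rw [← e.finrank_eq]
    exact Subspace.dual_finrank_eq.symm
  exact ⟨(LinearEquiv.ofInjectiveOfFinrankEq (G y : E →ₗ[ℝ] E →L[ℝ] ℝ) hinj
    hdim).toContinuousLinearEquiv, by ext; rfl⟩

theorem apply_christoffel [FiniteDimensional ℝ E] (hG : IsMetricOn G U) (hy : y ∈ U)
    (u v w : E) : G y (christoffel G y u v) w = christoffelFirst G y u v w := by
  rw [christoffel_apply, (hG.isInvertible hy).self_apply_inverse]

theorem christoffel_eq [FiniteDimensional ℝ E] (hG : IsMetricOn G U) (hy : y ∈ U)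
    {u v X : E} (h : ∀ w, G y X w = christoffelFirst G y u v w) : christoffel G y u v = X :=
  hG.eq_of_forall_apply_eq hy fun w => by rw [hG.apply_christoffel hy, h]

theorem christoffel_symm [FiniteDimensional ℝ E] (hG : IsMetricOn G U) (hy : y ∈ U)
    (u v : E) : christoffel G y u v = christoffel G y v u := by
  apply hG.christoffel_eq hy
  intro w
  rw [hG.apply_christoffel hy, christoffelFirst_apply, christoffelFirst_apply,
    hG.fderiv_symm hy u v w]
  ring

/-- Metric compatibility of the Levi-Civita connection. -/
theorem fderiv_eq_christoffel [FiniteDimensional ℝ E] (hG : IsMetricOn G U) (hy : y ∈ U)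
    (u v w : E) : fderiv ℝ G y u v w =
      G y (christoffel G y u v) w + G y v (christoffel G y u w) := by
  rw [hG.symm y hy v, hG.apply_christoffel hy, hG.apply_christoffel hy, christoffelFirst_apply,
    christoffelFirst_apply, hG.fderiv_symm hy w v u, hG.fderiv_symm hy v w u,
    hG.fderiv_symm hy u w v]
  ring

theorem differentiableAt_christoffel [FiniteDimensional ℝ E] (hG : IsMetricOn G U)
    (hy : y ∈ U) : DifferentiableAt ℝ (christoffel G) y := by
  have h1 : DifferentiableAt ℝ (fderiv ℝ G) y :=
    ((hG.contDiffAt hy).fderiv_right (m := 1) (by norm_cast)).differentiableAt (by simp)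
  have h2 : DifferentiableAt ℝ (fun z => (fderiv ℝ G z).flip) y :=
    (ContinuousLinearMap.flipₗᵢ ℝ E E (E →L[ℝ] ℝ)).differentiableAt.comp y h1
  have h3 : DifferentiableAt ℝ (christoffelFirst G) y :=
    ((h1.add h2).sub ((differentiableAt_const
      ((ContinuousLinearMap.flipₗᵢ ℝ E E ℝ).toContinuousLinearEquiv :
        (E →L[ℝ] E →L[ℝ] ℝ) →L[ℝ] (E →L[ℝ] E →L[ℝ] ℝ))).clm_comp h2)).const_smul (1 / 2 : ℝ)
  have h4 : DifferentiableAt ℝ (fun z => (G z).inverse) y :=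
    (((hG.isInvertible hy).contDiffAt_map_inverse (n := ∞)).comp y
      (hG.contDiffAt hy)).differentiableAt (by simp)
  exact ((ContinuousLinearMap.compL ℝ E (E →L[ℝ] ℝ) E).differentiableAt.comp y h4).clm_comp h3

theorem hasFDerivAt_christoffel_apply [FiniteDimensional ℝ E] (hG : IsMetricOn G U)
    (hy : y ∈ U) (v w : E) : HasFDerivAt (fun z => christoffel G z v w)
      (((fderiv ℝ (christoffel G) y).flip v).flip w) y := by
  have h := ((hG.differentiableAt_christoffel hy).hasFDerivAt.clm_apply
    (hasFDerivAt_const v y)).clm_apply (hasFDerivAt_const w y)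
  refine h.congr_fderiv ?_
  ext w
  simp

theorem fderiv_christoffel_apply [FiniteDimensional ℝ E] (hG : IsMetricOn G U)
    (hy : y ∈ U) (u v w : E) : fderiv ℝ (christoffel G) y u v w =
      fderiv ℝ (fun z => christoffel G z v w) y u := by
  rw [(hG.hasFDerivAt_christoffel_apply hy v w).fderiv]
  simp

end IsMetricOn

end LocalMetric

section LocalConformal

variable {E : Type*} [NormedAddCommGroup E] [NormedSpace ℝ E]
  {G : E → E →L[ℝ] E →L[ℝ] ℝ} {U : Set E} {y : E} {φ : ℝ → ℝ} {α : E →L[ℝ] ℝ} {a : E}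

theorem differentiable_deriv_of_contDiff (hφ : ContDiff ℝ ∞ φ) : Differentiable ℝ (deriv φ) :=
  (hφ.iterate_deriv 1).differentiable (by simp)

theorem hasDerivAt_logDeriv (hφ : ContDiff ℝ ∞ φ) (hpos : ∀ t, 0 < φ t) (t : ℝ) :
    HasDerivAt (fun t => deriv φ t / φ t)
      (deriv (deriv φ) t / φ t - (deriv φ t / φ t) ^ 2) t := by
  have h1 := (differentiable_deriv_of_contDiff hφ t).hasDerivAt
  have h2 := (hφ.differentiable (by simp) t).hasDerivAt
  have hne := (hpos t).ne'
  refine (h1.fun_div h2 hne).congr_deriv ?_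
  field_simp

theorem hasDerivAt_one_div_sq (hφ : ContDiff ℝ ∞ φ) (hpos : ∀ t, 0 < φ t) (t : ℝ) :
    HasDerivAt (fun t => 1 / φ t ^ 2) (-2 * (deriv φ t / φ t) * (1 / φ t ^ 2)) t := by
  have h2 := (hφ.differentiable (by simp) t).hasDerivAt
  have hne := (hpos t).ne'
  refine (((hasDerivAt_const t (1 : ℝ)).fun_div (h2.fun_pow 2) (pow_ne_zero 2 hne))).congr_deriv ?_
  field_simp
  simp
  ring

theorem IsMetricOn.conformal (hG : IsMetricOn G U) (hφ : ContDiff ℝ ∞ φ)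
    (hpos : ∀ t, 0 < φ t) : IsMetricOn (fun z => (1 / φ (α z) ^ 2) • G z) U where
  isOpen := hG.isOpen
  smooth := by
    have h : ContDiff ℝ ∞ fun z => 1 / φ (α z) ^ 2 :=
      contDiff_const.div ((hφ.comp α.contDiff).pow 2) fun z => pow_ne_zero 2 (hpos _).ne'
    exact h.contDiffOn.smul hG.smooth
  symm z hz u v := by simp [hG.symm z hz u v]
  nondegenerate z hz u hu := by
    apply hG.nondegenerate z hz
    intro v
    have := hu v
    have hne := (hpos (α z)).ne'
    simpa [hne] using this

variable [FiniteDimensional ℝ E]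

theorem christoffel_conformal (hG : IsMetricOn G U) (hφ : ContDiff ℝ ∞ φ)
    (hpos : ∀ t, 0 < φ t) (ha : ∀ z ∈ U, ∀ v, G z a v = α v) (hy : y ∈ U) (u v : E) :
    christoffel (fun z => (1 / φ (α z) ^ 2) • G z) y u v =
      christoffel G y u v - (deriv φ (α y) / φ (α y)) •
        (α u • v + α v • u - G y u v • a) := by
  have hC := hG.conformal (α := α) hφ hpos
  have hd : ∀ u v w, fderiv ℝ (fun z => (1 / φ (α z) ^ 2) • G z) y w u v =
      (1 / φ (α y) ^ 2) * fderiv ℝ G y w u v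
        - 2 * (deriv φ (α y) / φ (α y)) * (1 / φ (α y) ^ 2) * α w * G y u v := by
    intro u v w
    rw [← hC.fderiv_apply hy]
    have h1 : HasFDerivAt (fun z => 1 / φ (α z) ^ 2) _ y :=
      (hasDerivAt_one_div_sq hφ hpos (α y)).comp_hasFDerivAt y α.hasFDerivAt
    have h2 := h1.fun_mul (hG.hasFDerivAt_apply hy u v)
    have h3 : fderiv ℝ (fun z => ((1 / φ (α z) ^ 2) • G z) u v) y = _ := h2.fderiv
    rw [h3]
    simp
    ring
  apply hC.christoffel_eq hy
  intro w
  have h := hG.apply_christoffel hy u v w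
  rw [christoffelFirst_apply] at h
  rw [christoffelFirst_apply, hd, hd, hd]
  simp only [smul_apply, map_sub, map_add, map_smul,
    sub_apply, add_apply, smul_eq_mul, h, ha y hy]
  ring

theorem hessLocal_conformal (hG : IsMetricOn G U) (hφ : ContDiff ℝ ∞ φ)
    (hpos : ∀ t, 0 < φ t) (ha : ∀ z ∈ U, ∀ v, G z a v = α v)
    (hΓ : ∀ z ∈ U, ∀ u v, α (christoffel G z u v) = 0) (hy : y ∈ U) {h : ℝ → ℝ}
    (hh : ContDiff ℝ ∞ h) (u v : E) :
    hessLocal (fun z => (1 / φ (α z) ^ 2) • G z) (fun z => h (α z)) y u v =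
      deriv (deriv h) (α y) * α u * α v + (deriv φ (α y) / φ (α y)) * deriv h (α y) *
        (2 * α u * α v - α a * G y u v) := by
  have h1 : fderiv ℝ (fun z => h (α z)) = fun z => deriv h (α z) • α := by
    ext1 z
    exact (((hh.differentiable (by simp) (α z)).hasDerivAt).comp_hasFDerivAt z
      α.hasFDerivAt).fderiv
  have h2 : HasFDerivAt (fun z => deriv h (α z)) _ y :=
    ((differentiable_deriv_of_contDiff hh (α y)).hasDerivAt).comp_hasFDerivAt y α.hasFDerivAt
  rw [hessLocal, h1, (h2.smul_const α).fderiv, christoffel_conformal hG hφ hpos ha hy]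
  simp [hΓ y hy]
  ring

theorem ricciLocal_conformal (hG : IsMetricOn G U) (hφ : ContDiff ℝ ∞ φ)
    (hpos : ∀ t, 0 < φ t) (ha : ∀ z ∈ U, ∀ v, G z a v = α v)
    (hΓ : ∀ z ∈ U, ∀ u v, α (christoffel G z u v) = 0) (hy : y ∈ U) (v w : E) :
    ricciLocal (fun z => (1 / φ (α z) ^ 2) • G z) y v w =
      ricciLocal G y v w
        + ((Module.finrank ℝ E : ℝ) - 2) * (deriv (deriv φ) (α y) / φ (α y)) * (α v * α w)
        + α a * (deriv (deriv φ) (α y) / φ (α y)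
          - ((Module.finrank ℝ E : ℝ) - 1) * (deriv φ (α y) / φ (α y)) ^ 2) * G y v w := by
  have hC := hG.conformal (α := α) hφ hpos
  set p : ℝ := deriv φ (α y) / φ (α y) with hp
  set q : ℝ := deriv (deriv φ) (α y) / φ (α y) with hq
  have hΓa : ∀ u, christoffel G y u a = 0 := by
    intro u
    apply hG.nondegenerate y hy
    intro w
    have h1 := hG.fderiv_eq_christoffel hy u a w
    rw [← hG.fderiv_apply hy] at h1
    have h2 : (fun z => G z a w) =ᶠ[nhds y] fun _ => α w := by
      filter_upwards [hG.isOpen.mem_nhds hy] with z hz using ha z hz w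
    rw [h2.fderiv_eq, ha y hy, hΓ y hy] at h1
    simpa using h1.symm
  have hd : ∀ u v w, fderiv ℝ (christoffel (fun z => (1 / φ (α z) ^ 2) • G z)) y u v w =
      fderiv ℝ (christoffel G) y u v w
        - ((q - p ^ 2) * α u) • (α v • w + α w • v - G y v w • a)
        + (p * (G y (christoffel G y u v) w + G y v (christoffel G y u w))) • a := by
    intro u v w
    rw [hC.fderiv_christoffel_apply hy]
    have h1 : (fun z => christoffel (fun z => (1 / φ (α z) ^ 2) • G z) z v w) =ᶠ[nhds y]
        fun z => christoffel G z v w - (deriv φ (α z) / φ (α z)) •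
          (α v • w + α w • v - G z v w • a) := by
      filter_upwards [hG.isOpen.mem_nhds hy] with z hz using
        christoffel_conformal hG hφ hpos ha hz v w
    have h2 : HasFDerivAt (fun z => deriv φ (α z) / φ (α z)) _ y :=
      (hasDerivAt_logDeriv hφ hpos (α y)).comp_hasFDerivAt y α.hasFDerivAt
    have h3 := (hG.hasFDerivAt_christoffel_apply hy v w).fun_sub (h2.fun_smul
      (((hG.hasFDerivAt_apply hy v w).smul_const a).const_sub (α v • w + α w • v)))
    rw [h1.fderiv_eq, h3.fderiv, ← hG.fderiv_eq_christoffel hy]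
    simp [← hp, ← hq]
    module
  have haG : ∀ x, G y x a = α x := fun x => by rw [hG.symm y hy, ha y hy]
  have hcurv : (curvature (fun z => (1 / φ (α z) ^ 2) • G z) y v w : E →ₗ[ℝ] E) =
      (curvature G y v w : E →ₗ[ℝ] E)
      + (q * (α v * α w) - p ^ 2 * α a * G y v w) • (LinearMap.id : E →ₗ[ℝ] E)
      + (α : E →ₗ[ℝ] ℝ).smulRight
          ((-q) • (α w • v - G y v w • a))
      + ((G y w : E →L[ℝ] ℝ) : E →ₗ[ℝ] ℝ).smulRight
          ((p ^ 2 * α a) • v - (q * α v) • a) := by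
    ext u
    simp only [ContinuousLinearMap.coe_coe, LinearMap.add_apply, LinearMap.smul_apply,
      LinearMap.id_apply, LinearMap.smulRight_apply, curvature_apply, hd,
      christoffel_conformal hG hφ hpos ha hy]
    simp only [map_sub, map_add, map_smul, hΓ y hy, hΓa, haG, ← hp,
      hG.christoffel_symm hy v u, hG.symm y hy w u, hG.symm y hy v u,
      smul_eq_mul]
    module
  rw [ricciLocal, ricciLocal, hcurv]
  simp only [map_add, map_smul, LinearMap.trace_id, LinearMap.trace_smulRight,
    ContinuousLinearMap.coe_coe, map_sub, smul_eq_mul]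
  rw [hG.symm y hy w v, haG]
  ring

end LocalConformal

section LocalProduct

variable {E E' : Type*} [NormedAddCommGroup E] [NormedSpace ℝ E]
  [NormedAddCommGroup E'] [NormedSpace ℝ E']

/-- The product `η + γ` of a constant metric `η` and a metric `γ`, in coordinates. -/
def prodLocal (η : E →L[ℝ] E →L[ℝ] ℝ) (γ : E' → E' →L[ℝ] E' →L[ℝ] ℝ) (z : E × E') :
    E × E' →L[ℝ] E × E' →L[ℝ] ℝ :=
  η.bilinearComp (ContinuousLinearMap.fst ℝ E E') (ContinuousLinearMap.fst ℝ E E') +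
    (γ z.2).bilinearComp (ContinuousLinearMap.snd ℝ E E') (ContinuousLinearMap.snd ℝ E E')

@[simp]
theorem prodLocal_apply (η : E →L[ℝ] E →L[ℝ] ℝ) (γ : E' → E' →L[ℝ] E' →L[ℝ] ℝ)
    (z u v : E × E') : prodLocal η γ z u v = η u.1 v.1 + γ z.2 u.2 v.2 := rfl

variable [FiniteDimensional ℝ E] [FiniteDimensional ℝ E']
  {η : E →L[ℝ] E →L[ℝ] ℝ} {γ : E' → E' →L[ℝ] E' →L[ℝ] ℝ} {V : Set E'} {y : E × E'}

theorem IsMetricOn.prodLocal (hγ : IsMetricOn γ V) (hη : ∀ u v, η u v = η v u)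
    (hη' : ∀ u, (∀ v, η u v = 0) → u = 0) :
    IsMetricOn (prodLocal η γ) (Set.univ ×ˢ V) where
  isOpen := isOpen_univ.prod hγ.isOpen
  smooth := by
    refine contDiffOn_clm_apply.2 fun u => contDiffOn_clm_apply.2 fun v => ?_
    have h : ContDiffOn ℝ ∞ (fun z : E × E' => γ z.2) (Set.univ ×ˢ V) :=
      hγ.smooth.comp contDiff_snd.contDiffOn fun z hz => hz.2
    exact contDiffOn_const.add ((h.clm_apply contDiffOn_const).clm_apply contDiffOn_const)
  symm z hz u v := by simp [hη u.1, hγ.symm z.2 hz.2 u.2]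
  nondegenerate z hz u hu := by
    refine Prod.ext (hη' _ fun v => ?_) (hγ.nondegenerate z.2 hz.2 _ fun v => ?_)
    · simpa using hu (v, 0)
    · simpa using hu (0, v)

theorem christoffel_prodLocal (hγ : IsMetricOn γ V) (hη : ∀ u v, η u v = η v u)
    (hη' : ∀ u, (∀ v, η u v = 0) → u = 0) (hy : y.2 ∈ V) (u v : E × E') :
    christoffel (prodLocal η γ) y u v = (0, christoffel γ y.2 u.2 v.2) := by
  have hP := hγ.prodLocal hη hη'
  have hyP : y ∈ (Set.univ : Set E) ×ˢ V := ⟨trivial, hy⟩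
  have hd : ∀ w u v, fderiv ℝ (prodLocal η γ) y w u v = fderiv ℝ γ y.2 w.2 u.2 v.2 := by
    intro w u v
    rw [← hP.fderiv_apply hyP]
    have h : HasFDerivAt (fun z : E × E' => prodLocal η γ z u v) _ y :=
      ((hγ.hasFDerivAt_apply hy u.2 v.2).comp y hasFDerivAt_snd).const_add (η u.1 v.1)
    rw [h.fderiv]
    simp
  apply hP.christoffel_eq hyP
  intro w
  rw [christoffelFirst_apply, hd, hd, hd, ← christoffelFirst_apply, prodLocal_apply,
    ← hγ.apply_christoffel hy]
  simp

theorem ricciLocal_prodLocal (hγ : IsMetricOn γ V) (hη : ∀ u v, η u v = η v u)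
    (hη' : ∀ u, (∀ v, η u v = 0) → u = 0) (hy : y.2 ∈ V) (v w : E × E') :
    ricciLocal (prodLocal η γ) y v w = ricciLocal γ y.2 v.2 w.2 := by
  have hP := hγ.prodLocal hη hη'
  have hyP : y ∈ (Set.univ : Set E) ×ˢ V := ⟨trivial, hy⟩
  have hd : ∀ u v w, fderiv ℝ (christoffel (prodLocal η γ)) y u v w =
      (0, fderiv ℝ (christoffel γ) y.2 u.2 v.2 w.2) := by
    intro u v w
    rw [hP.fderiv_christoffel_apply hyP]
    have h1 : (fun z => christoffel (prodLocal η γ) z v w) =ᶠ[nhds y]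
        fun z => (0, christoffel γ z.2 v.2 w.2) := by
      filter_upwards [hP.isOpen.mem_nhds hyP] with z hz using
        christoffel_prodLocal hγ hη hη' hz.2 v w
    have h2 : HasFDerivAt (fun z : E × E' => ((0 : E), christoffel γ z.2 v.2 w.2)) _ y :=
      (hasFDerivAt_const (0 : E) y).prodMk
        ((hγ.hasFDerivAt_christoffel_apply hy v.2 w.2).comp y hasFDerivAt_snd)
    rw [h1.fderiv_eq, h2.fderiv]
    simp
  have hcurv : (curvature (prodLocal η γ) y v w : E × E' →ₗ[ℝ] E × E') =
      LinearMap.inr ℝ E E' ∘ₗ ((curvature γ y.2 v.2 w.2 : E' →ₗ[ℝ] E') ∘ₗ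
        LinearMap.snd ℝ E E') := by
    refine LinearMap.ext fun u => ?_
    simp only [ContinuousLinearMap.coe_coe, LinearMap.comp_apply, LinearMap.snd_apply,
      curvature_apply, hd, christoffel_prodLocal hγ hη hη' hy]
    simp
  rw [ricciLocal, ricciLocal, hcurv, LinearMap.trace_comp_comm', LinearMap.comp_assoc,
    LinearMap.snd_comp_inr, LinearMap.comp_id]

/-- The product of a constant metric and a Ricci-flat metric, rescaled by the conformal factor
`φ⁻²` with `φ` a function of a linear coordinate `α` on the flat factor. -/
theorem ricciLocal_add_hessLocal_conformal_prodLocal (hγ : IsMetricOn γ V)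
    (hη : ∀ u v, η u v = η v u) (hη' : ∀ u, (∀ v, η u v = 0) → u = 0)
    (hric : ∀ v w, ricciLocal γ y.2 v w = 0)
    {α : E →L[ℝ] ℝ} {a : E} (ha : ∀ v, η a v = α v) {φ : ℝ → ℝ} (hφ : ContDiff ℝ ∞ φ)
    (hpos : ∀ t, 0 < φ t) {h : ℝ → ℝ} (hh : ContDiff ℝ ∞ h) {r : ℝ}
    (hode : deriv (deriv h) (α y.1) + 2 * (deriv φ (α y.1) / φ (α y.1)) * deriv h (α y.1) +
      ((Module.finrank ℝ E : ℝ) + Module.finrank ℝ E' - 2) *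
        (deriv (deriv φ) (α y.1) / φ (α y.1)) = 0)
    (hr : r = α a * (φ (α y.1) * deriv (deriv φ) (α y.1) -
      ((Module.finrank ℝ E : ℝ) + Module.finrank ℝ E' - 1) * deriv φ (α y.1) ^ 2 -
      φ (α y.1) * deriv φ (α y.1) * deriv h (α y.1)))
    (hy : y.2 ∈ V) (u v : E × E') :
    ricciLocal (fun z => (1 / φ (α z.1) ^ 2) • prodLocal η γ z) y u v +
      hessLocal (fun z => (1 / φ (α z.1) ^ 2) • prodLocal η γ z) (fun z => h (α z.1)) y u v =
    r * (1 / φ (α y.1) ^ 2 * prodLocal η γ y u v) := by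
  have hP := hγ.prodLocal hη hη'
  have hyP : y ∈ (Set.univ : Set E) ×ˢ V := ⟨trivial, hy⟩
  have haP : ∀ z ∈ (Set.univ : Set E) ×ˢ V, ∀ v,
      prodLocal η γ z (a, 0) v = (α ∘L ContinuousLinearMap.fst ℝ E E') v := by
    intro z _ v
    simp [ha]
  have hΓ : ∀ z ∈ (Set.univ : Set E) ×ˢ V, ∀ u v,
      (α ∘L ContinuousLinearMap.fst ℝ E E') (christoffel (prodLocal η γ) z u v) = 0 := by
    intro z hz u v
    simp [christoffel_prodLocal hγ hη hη' hz.2]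
  have h1 := ricciLocal_conformal hP hφ hpos haP hΓ hyP u v
  have h2 := hessLocal_conformal hP hφ hpos haP hΓ hyP hh u v
  rw [ricciLocal_prodLocal hγ hη hη' hy, hric] at h1
  simp only [ContinuousLinearMap.comp_apply, ContinuousLinearMap.coe_fst',
    Module.finrank_prod, Nat.cast_add] at h1 h2
  rw [h1, h2, hr]
  have hne := (hpos (α y.1)).ne'
  have key : α a * (φ (α y.1) * deriv (deriv φ) (α y.1) -
      ((Module.finrank ℝ E : ℝ) + Module.finrank ℝ E' - 1) * deriv φ (α y.1) ^ 2 -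
      φ (α y.1) * deriv φ (α y.1) * deriv h (α y.1)) *
        (1 / φ (α y.1) ^ 2 * prodLocal η γ y u v) =
      α a * (deriv (deriv φ) (α y.1) / φ (α y.1) -
        ((Module.finrank ℝ E : ℝ) + Module.finrank ℝ E' - 1) *
          (deriv φ (α y.1) / φ (α y.1)) ^ 2 -
        deriv φ (α y.1) / φ (α y.1) * deriv h (α y.1)) * prodLocal η γ y u v := by
    field_simp
  rw [key]
  linear_combination α u.1 * α v.1 * hode

end LocalProduct

section Charts

variable {E : Type*} [NormedAddCommGroup E] [NormedSpace ℝ E] {H : Type*} [TopologicalSpace H]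
  {I : ModelWithCorners ℝ E H} {M : Type*} [TopologicalSpace M]
  [ChartedSpace H M] [IsManifold I ∞ M]

theorem ricci_eq_ricciLocal (g : BilinField I M) (x : M) (u v : TangentSpace I x) :
    ricci g x u v = ricciLocal (g.inChart x) (extChartAt I x x) u v := by
  have : IsManifold I 1 M := IsManifold.of_le (n := ∞) (by norm_cast)
  have hA : ∀ w, mfderiv I 𝓘(ℝ, E) (extChartAt I x) x w = w := fun w =>
    DFunLike.congr_fun (mfderiv_extChartAt_self (I := I) (x := x)) w
  unfold ricci
  rw [hA u, hA v]

theorem hess_eq_hessLocal (g : BilinField I M) (h : M → ℝ) (x : M) (u v : TangentSpace I x) :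
    hess g h x u v =
      hessLocal (g.inChart x) (h ∘ (extChartAt I x).symm) (extChartAt I x x) u v := by
  have : IsManifold I 1 M := IsManifold.of_le (n := ∞) (by norm_cast)
  have hA : ∀ w, mfderiv I 𝓘(ℝ, E) (extChartAt I x) x w = w := fun w =>
    DFunLike.congr_fun (mfderiv_extChartAt_self (I := I) (x := x)) w
  unfold hess
  rw [hA u, hA v]

theorem ricciLocal_eq_zero_of_isRicciFlat {g : BilinField I M} (hg : IsRicciFlat g) (x : M)
    (u v : E) : ricciLocal (g.inChart x) (extChartAt I x x) u v = 0 :=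
  (ricci_eq_ricciLocal g x u v).symm.trans (hg x u v)

variable [I.Boundaryless]

theorem IsSemiRiemannian.isMetricOn {g : BilinField I M} (hg : IsSemiRiemannian g) (x₀ : M) :
    IsMetricOn (g.inChart x₀) (extChartAt I x₀).target where
  isOpen := isOpen_extChartAt_target x₀
  smooth := hg.smooth x₀
  symm y _ u v := by
    let A : E →L[ℝ] E := mfderiv 𝓘(ℝ, E) I (extChartAt I x₀).symm y
    exact hg.symm ((extChartAt I x₀).symm y) (A u) (A v)
  nondegenerate y hy u hu := by
    have : IsManifold I 1 M := IsManifold.of_le (n := ∞) (by norm_cast)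
    have hinv := isInvertible_mfderivWithin_extChartAt_symm (I := I) hy
    rw [I.range_eq_univ, mfderivWithin_univ] at hinv
    let A : E →L[ℝ] E := mfderiv 𝓘(ℝ, E) I (extChartAt I x₀).symm y
    have hA : Function.Bijective A := hinv.bijective
    refine hA.injective ((?_ : A u = 0).trans (map_zero A).symm)
    refine hg.nondegenerate ((extChartAt I x₀).symm y) (A u) fun v => ?_
    obtain ⟨w, hw⟩ := hA.surjective v
    rw [← hw]
    exact hu w

theorem BilinField.inChart_extChartAt_self (g : BilinField I M) (x : M) (u v : E) :
    g.inChart x (extChartAt I x x) u v = (g x : E →L[ℝ] E →L[ℝ] ℝ) u v := by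
  have : IsManifold I 1 M := IsManifold.of_le (n := ∞) (by norm_cast)
  have hA := mfderivWithin_range_extChartAt_symm (I := I) (x := x)
  rw [I.range_eq_univ, mfderivWithin_univ] at hA
  have hg : ∀ x', x' = x → (g x' : E →L[ℝ] E →L[ℝ] ℝ) = g x := fun x' h => by rw [h]
  let A : E →L[ℝ] E := mfderiv 𝓘(ℝ, E) I (extChartAt I x).symm (extChartAt I x x)
  have hA' : ∀ w, A w = w := fun w => DFunLike.congr_fun hA w
  change (g ((extChartAt I x).symm (extChartAt I x x)) : E →L[ℝ] E →L[ℝ] ℝ) (A u) (A v) = _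
  rw [hA', hA', hg _ (extChartAt_to_inv x)]
  rfl

end Charts

/-- A bilinear form as a constant tensor field on a vector space. -/
def BilinField.const {E : Type*} [NormedAddCommGroup E] [NormedSpace ℝ E]
    (η : E →L[ℝ] E →L[ℝ] ℝ) : BilinField 𝓘(ℝ, E) E := fun _ => η

section ProductCharts

variable {E : Type*} [NormedAddCommGroup E] [NormedSpace ℝ E]
  {E' : Type*} [NormedAddCommGroup E'] [NormedSpace ℝ E'] {H' : Type*} [TopologicalSpace H']
  {J : ModelWithCorners ℝ E' H'} {F : Type*} [TopologicalSpace F] [ChartedSpace H' F]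

theorem extChartAt_vectorSpace_prod_symm (x₀ : E × F) :
    ((extChartAt (𝓘(ℝ, E).prod J) x₀).symm : E × E' → E × F) =
      fun z => (z.1, (extChartAt J x₀.2).symm z.2) := by
  rw [extChartAt_prod]
  rfl

theorem extChartAt_vectorSpace_prod_target (x₀ : E × F) :
    (extChartAt (𝓘(ℝ, E).prod J) x₀).target = Set.univ ×ˢ (extChartAt J x₀.2).target := by
  rw [extChartAt_prod, extChartAt_model_space_eq_id]
  rfl

theorem extChartAt_vectorSpace_prod_self (x : E × F) :
    extChartAt (𝓘(ℝ, E).prod J) x x = (x.1, extChartAt J x.2 x.2) := by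
  rw [extChartAt_prod]
  rfl

variable [J.Boundaryless] [IsManifold J ∞ F]

theorem mfderiv_extChartAt_vectorSpace_prod_symm (x₀ : E × F) {y : E × E'}
    (hy : y.2 ∈ (extChartAt J x₀.2).target) :
    mfderiv 𝓘(ℝ, E × E') (𝓘(ℝ, E).prod J) (extChartAt (𝓘(ℝ, E).prod J) x₀).symm y =
      (ContinuousLinearMap.fst ℝ E E').prod
        ((mfderiv 𝓘(ℝ, E') J (extChartAt J x₀.2).symm y.2 : E' →L[ℝ] E') ∘L
          (ContinuousLinearMap.snd ℝ E E')) := by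
  have : IsManifold J 1 F := IsManifold.of_le (n := ∞) (by norm_cast)
  have h1 : MDifferentiableWithinAt 𝓘(ℝ, E') J (extChartAt J x₀.2).symm (Set.range J) y.2 :=
    mdifferentiableWithinAt_extChartAt_symm hy
  rw [J.range_eq_univ, mdifferentiableWithinAt_univ] at h1
  have h2 : HasMFDerivAt 𝓘(ℝ, E × E') 𝓘(ℝ, E) (Prod.fst : E × E' → E) y
    (ContinuousLinearMap.fst ℝ E E') := hasFDerivAt_fst.hasMFDerivAt
  have h3 : HasMFDerivAt 𝓘(ℝ, E × E') 𝓘(ℝ, E') (Prod.snd : E × E' → E') y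
    (ContinuousLinearMap.snd ℝ E E') := hasFDerivAt_snd.hasMFDerivAt
  rw [extChartAt_vectorSpace_prod_symm]
  exact (h2.prodMk (h1.hasMFDerivAt.comp y h3)).mfderiv

/-- The coordinate expression of the metric `ψ⁻² (η + g_F)`. -/
theorem inChart_warpedProduct_conformal (η : E →L[ℝ] E →L[ℝ] ℝ) (gF : BilinField J F)
    (ψ f : E → ℝ) (hf : ∀ x, f x = 1 / ψ x) (x₀ : E × F) {y : E × E'}
    (hy : y.2 ∈ (extChartAt J x₀.2).target) :
    (warpedProduct (conformal ψ (BilinField.const η)) f gF).inChart x₀ y =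
      (1 / ψ y.1 ^ 2) • prodLocal η (gF.inChart x₀.2) y := by
  have hf' : f y.1 ^ 2 = 1 / ψ y.1 ^ 2 := by rw [hf, div_pow, one_pow]
  refine ContinuousLinearMap.ext fun u => ContinuousLinearMap.ext fun v => ?_
  rw [BilinField.inChart_apply, mfderiv_extChartAt_vectorSpace_prod_symm x₀ hy]
  let A : E' →L[ℝ] E' := mfderiv 𝓘(ℝ, E') J (extChartAt J x₀.2).symm y.2
  let γ : E' →L[ℝ] E' →L[ℝ] ℝ := gF ((extChartAt J x₀.2).symm y.2)
  have key : 1 / ψ y.1 ^ 2 * η u.1 v.1 + f y.1 ^ 2 * γ (A u.2) (A v.2) =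
      1 / ψ y.1 ^ 2 * (η u.1 v.1 + γ (A u.2) (A v.2)) := by
    rw [hf']
    ring
  rw [extChartAt_vectorSpace_prod_symm]
  exact key

end ProductCharts

section Germ

variable {E : Type*} [NormedAddCommGroup E] [NormedSpace ℝ E]
  {G G' : E → E →L[ℝ] E →L[ℝ] ℝ} {y : E}

theorem christoffel_congr (h : G =ᶠ[nhds y] G') : christoffel G y = christoffel G' y := by
  unfold christoffel christoffelFirst
  rw [h.fderiv_eq, h.eq_of_nhds]

theorem ricciLocal_congr (h : G =ᶠ[nhds y] G') (v w : E) :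
    ricciLocal G y v w = ricciLocal G' y v w := by
  have h' : christoffel G =ᶠ[nhds y] christoffel G' :=
    h.eventuallyEq_nhds.mono fun z hz => christoffel_congr hz
  unfold ricciLocal curvature
  rw [h'.fderiv_eq, h'.eq_of_nhds]

theorem hessLocal_congr (h : G =ᶠ[nhds y] G') (f : E → ℝ) (u v : E) :
    hessLocal G f y u v = hessLocal G' f y u v := by
  unfold hessLocal
  rw [christoffel_congr h]

end Germ

section Primitive

/-- A smooth function on `ℝ` has smooth primitives. -/
theorem contDiff_intervalIntegral {p : ℝ → ℝ} (hp : ContDiff ℝ ∞ p) (a : ℝ) :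
    ContDiff ℝ ∞ fun t => ∫ s in a..t, p s := by
  have hd : ∀ t, HasDerivAt (fun t => ∫ s in a..t, p s) (p t) t :=
    fun t => (hp.continuous.integral_hasStrictDerivAt a t).hasDerivAt
  refine contDiff_infty_iff_deriv.2 ⟨fun t => (hd t).differentiableAt, ?_⟩
  rwa [funext fun t => (hd t).deriv]

/-- The potential `h` solves `φ² h' = k - N ∫ φ φ''`. -/
theorem contDiff_potential {φ : ℝ → ℝ} (hφ : ContDiff ℝ ∞ φ) (hpos : ∀ t, 0 < φ t)
    {a b c k N : ℝ} {h : ℝ → ℝ}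
    (hh : ∀ t, h t = c + k * (∫ s in b..t, 1 / φ s ^ 2)
      - N * ∫ s in b..t, (∫ r in a..s, φ r * deriv (deriv φ) r) * (1 / φ s ^ 2)) :
    ContDiff ℝ ∞ h ∧
    (∀ t, deriv h t = (k - N * ∫ r in a..t, φ r * deriv (deriv φ) r) * (1 / φ t ^ 2)) ∧
    ∀ t, deriv (deriv h) t + 2 * (deriv φ t / φ t) * deriv h t +
      N * (deriv (deriv φ) t / φ t) = 0 := by
  have hq : ContDiff ℝ ∞ fun s => 1 / φ s ^ 2 :=
    contDiff_const.div (hφ.pow 2) fun s => pow_ne_zero 2 (hpos s).ne'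
  have hp : ContDiff ℝ ∞ fun r => φ r * deriv (deriv φ) r := hφ.mul (hφ.iterate_deriv 2)
  have hP := contDiff_intervalIntegral hp a
  have hPq := hP.mul hq
  have hder : ∀ t, HasDerivAt h
      ((k - N * ∫ r in a..t, φ r * deriv (deriv φ) r) * (1 / φ t ^ 2)) t := by
    intro t
    have h1 := (hq.continuous.integral_hasStrictDerivAt b t).hasDerivAt
    have h2 := (hPq.continuous.integral_hasStrictDerivAt b t).hasDerivAt
    rw [funext hh]
    refine (((h1.const_mul k).const_add c).fun_sub (h2.const_mul N)).congr_deriv ?_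
    ring
  have hder' : deriv h = fun t =>
      (k - N * ∫ r in a..t, φ r * deriv (deriv φ) r) * (1 / φ t ^ 2) :=
    funext fun t => (hder t).deriv
  refine ⟨?_, fun t => (hder t).deriv, fun t => ?_⟩
  · rw [funext hh]
    exact (contDiff_const.add (contDiff_const.mul (contDiff_intervalIntegral hq b))).sub
      (contDiff_const.mul (contDiff_intervalIntegral hPq b))
  · have h1 := ((((hp.continuous.integral_hasStrictDerivAt a t).hasDerivAt).const_mul N).const_sub
      k).fun_mul (hasDerivAt_one_div_sq hφ hpos t)
    rw [hder', h1.deriv]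
    have := (hpos t).ne'
    field_simp
    ring

end Primitive

section WarpedProductSoliton

variable {E : Type*} [NormedAddCommGroup E] [NormedSpace ℝ E]
  {E' : Type*} [NormedAddCommGroup E'] [NormedSpace ℝ E']
  {H' : Type*} [TopologicalSpace H'] {J : ModelWithCorners ℝ E' H'}
  {F : Type*} [TopologicalSpace F] [ChartedSpace H' F]
  {η : E →L[ℝ] E →L[ℝ] ℝ} {gF : BilinField J F}

theorem warpedProduct_conformal_const_apply {ψ f : E → ℝ} (hf : ∀ x, f x = 1 / ψ x)
    (x : E × F) (u v : TangentSpace (𝓘(ℝ, E).prod J) x) :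
    warpedProduct (conformal ψ (BilinField.const η)) f gF x u v =
      1 / ψ x.1 ^ 2 * (η (u : E × E').1 (v : E × E').1 +
        gF x.2 (u : E × E').2 (v : E × E').2) := by
  have hf' : f x.1 ^ 2 = 1 / ψ x.1 ^ 2 := by rw [hf, div_pow, one_pow]
  rw [mul_add, ← hf']
  nth_rw 1 [hf']
  rfl

variable [FiniteDimensional ℝ E] [FiniteDimensional ℝ E'] [J.Boundaryless] [IsManifold J ∞ F]

theorem IsSemiRiemannian.warpedProduct_conformal (hgF : IsSemiRiemannian gF)
    (hη : ∀ u v, η u v = η v u) (hη' : ∀ u, (∀ v, η u v = 0) → u = 0)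
    {ψ f : E → ℝ} (hψ : ContDiff ℝ ∞ ψ) (hpos : ∀ x, 0 < ψ x) (hf : ∀ x, f x = 1 / ψ x) :
    IsSemiRiemannian (warpedProduct (conformal ψ (BilinField.const η)) f gF) where
  symm x u v := by
    let w : E × E' := u
    let w' : E × E' := v
    have hγ : (gF x.2 w.2 w'.2 : ℝ) = gF x.2 w'.2 w.2 := hgF.symm x.2 w.2 w'.2
    refine (warpedProduct_conformal_const_apply hf x u v).trans
      (Eq.trans ?_ (warpedProduct_conformal_const_apply hf x v u).symm)
    exact congrArg _ (congrArg₂ (· + ·) (hη w.1 w'.1) hγ)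
  nondegenerate x u hu := by
    have hne := (hpos x.1).ne'
    let γ : E' →L[ℝ] E' →L[ℝ] ℝ := gF x.2
    let w : E × E' := u
    have h1 : ∀ v : E × E', η w.1 v.1 + γ w.2 v.2 = 0 := by
      intro v
      have h := (warpedProduct_conformal_const_apply hf x u v).symm.trans (hu v)
      exact (mul_eq_zero.1 h).resolve_left (one_div_ne_zero (pow_ne_zero 2 hne))
    have h2 : w.1 = 0 := hη' _ fun v => by simpa using h1 (v, 0)
    have h3 : ∀ v, γ w.2 v = 0 := fun v => by simpa using h1 (0, v)
    exact Prod.ext h2 (hgF.nondegenerate x.2 w.2 h3)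
  constant_index x y := by
    obtain ⟨T, hT⟩ := hgF.constant_index x.2 y.2
    have hx := (hpos x.1).ne'
    have hy := (hpos y.1).ne'
    let T' : E' ≃L[ℝ] E' := T
    let S : (E × E') ≃L[ℝ] (E × E') :=
      ((ContinuousLinearEquiv.refl ℝ E).prodCongr T').trans
        (ContinuousLinearEquiv.smulLeft (Units.mk0 (ψ y.1 / ψ x.1) (div_ne_zero hy hx)))
    refine ⟨S, fun u v => ?_⟩
    rw [warpedProduct_conformal_const_apply hf, warpedProduct_conformal_const_apply hf]
    let γ : E' →L[ℝ] E' →L[ℝ] ℝ := gF y.2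
    let w : E × E' := u
    let w' : E × E' := v
    have hTw : γ (T' w.2) (T' w'.2) = gF x.2 w.2 w'.2 := hT w.2 w'.2
    have key : 1 / ψ y.1 ^ 2 * (η ((ψ y.1 / ψ x.1) • w.1) ((ψ y.1 / ψ x.1) • w'.1) +
        γ ((ψ y.1 / ψ x.1) • T' w.2) ((ψ y.1 / ψ x.1) • T' w'.2)) =
        1 / ψ x.1 ^ 2 * (η w.1 w'.1 + γ (T' w.2) (T' w'.2)) := by
      simp only [map_smul, smul_apply, smul_eq_mul]
      field_simp
    rw [hTw] at key
    exact key
  smooth x₀ := by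
    have hM := (hgF.isMetricOn x₀.2).prodLocal hη hη'
    have hq : ContDiff ℝ ∞ fun z : E × E' => 1 / ψ z.1 ^ 2 :=
      contDiff_const.div ((hψ.comp contDiff_fst).pow 2) fun z => pow_ne_zero 2 (hpos _).ne'
    rw [extChartAt_vectorSpace_prod_target]
    exact (hq.contDiffOn.smul hM.smooth).congr fun y hy =>
      inChart_warpedProduct_conformal η gF ψ f hf x₀ hy.2

theorem ricci_add_hess_warpedProduct_conformal (hgF : IsSemiRiemannian gF)
    (hRic : IsRicciFlat gF) (hη : ∀ u v, η u v = η v u)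
    (hη' : ∀ u, (∀ v, η u v = 0) → u = 0) {α : E →L[ℝ] ℝ} {a : E} (ha : ∀ v, η a v = α v)
    {φ : ℝ → ℝ} (hφ : ContDiff ℝ ∞ φ) (hpos : ∀ t, 0 < φ t)
    {f : ℝ → ℝ} (hf : ∀ t, f t = 1 / φ t) {h : ℝ → ℝ} (hh : ContDiff ℝ ∞ h)
    (hode : ∀ t, deriv (deriv h) t + 2 * (deriv φ t / φ t) * deriv h t +
      ((Module.finrank ℝ E : ℝ) + Module.finrank ℝ E' - 2) *
        (deriv (deriv φ) t / φ t) = 0) {ρ : ℝ → ℝ}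
    (hρ : ∀ t, ρ t = α a * (φ t * deriv (deriv φ) t -
      ((Module.finrank ℝ E : ℝ) + Module.finrank ℝ E' - 1) * deriv φ t ^ 2 -
      φ t * deriv φ t * deriv h t))
    (x : E × F) (u v : TangentSpace (𝓘(ℝ, E).prod J) x) :
    ricci (warpedProduct (conformal (fun x => φ (α x)) (BilinField.const η))
        (fun x => f (α x)) gF) x u v +
      hess (warpedProduct (conformal (fun x => φ (α x)) (BilinField.const η))
        (fun x => f (α x)) gF) (fun p => h (α p.1)) x u v =
      ρ (α x.1) * warpedProduct (conformal (fun x => φ (α x)) (BilinField.const η))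
        (fun x => f (α x)) gF x u v := by
  have hγ := hgF.isMetricOn x.2
  have hy := mem_extChartAt_target (I := J) x.2
  have hgerm : (warpedProduct (conformal (fun x => φ (α x)) (BilinField.const η))
      (fun x => f (α x)) gF).inChart x =ᶠ[nhds (x.1, extChartAt J x.2 x.2)]
      fun z => (1 / φ (α z.1) ^ 2) • prodLocal η (gF.inChart x.2) z := by
    filter_upwards [(isOpen_univ.prod hγ.isOpen).mem_nhds
      (show (x.1, extChartAt J x.2 x.2) ∈ Set.univ ×ˢ (extChartAt J x.2).target from
        ⟨trivial, hy⟩)] with z hz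
    exact inChart_warpedProduct_conformal η gF (fun x => φ (α x)) (fun x => f (α x))
      (fun x => hf (α x)) x hz.2
  have key := ricciLocal_add_hessLocal_conformal_prodLocal hγ (y := (x.1, extChartAt J x.2 x.2))
    hη hη' (ricciLocal_eq_zero_of_isRicciFlat hRic x.2) ha hφ hpos hh (hode _) (hρ (α x.1)) hy u v
  have h1 := ricci_eq_ricciLocal (warpedProduct (conformal (fun x => φ (α x))
    (BilinField.const η)) (fun x => f (α x)) gF) x u v
  have h2 := hess_eq_hessLocal (warpedProduct (conformal (fun x => φ (α x))
    (BilinField.const η)) (fun x => f (α x)) gF) (fun p => h (α p.1)) x u v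
  rw [extChartAt_vectorSpace_prod_self] at h1 h2
  rw [extChartAt_vectorSpace_prod_symm] at h2
  refine (congrArg₂ (· + ·) (h1.trans (ricciLocal_congr hgerm u v))
    (h2.trans (hessLocal_congr hgerm _ u v))).trans (key.trans (congrArg _ ?_))
  let w : E × E' := u
  let w' : E × E' := v
  have hw := gF.inChart_extChartAt_self x.2 w.2 w'.2
  exact (congrArg (fun s => 1 / φ (α x.1) ^ 2 * (η w.1 w'.1 + s)) hw).trans (warpedProduct_conformal_const_apply (fun x => hf (α x)) x u v).symm

end WarpedProductSoliton

/-- The bilinear form `∑ εᵢ xᵢ yᵢ` on `ℝⁿ`. -/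
def pseudoInner {n : ℕ} (ε : Fin n → ℝ) :
    EuclideanSpace ℝ (Fin n) →L[ℝ] EuclideanSpace ℝ (Fin n) →L[ℝ] ℝ :=
  ∑ i, ε i • (EuclideanSpace.proj i : EuclideanSpace ℝ (Fin n) →L[ℝ] ℝ).smulRight
    (EuclideanSpace.proj i : EuclideanSpace ℝ (Fin n) →L[ℝ] ℝ)

theorem pseudoInner_apply {n : ℕ} (ε : Fin n → ℝ) (u v : EuclideanSpace ℝ (Fin n)) :
    pseudoInner ε u v = ∑ i, ε i * (u i * v i) :=
  pseudoEuclidean_apply ε 0 u v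

theorem pseudoInner_symm {n : ℕ} (ε : Fin n → ℝ) (u v : EuclideanSpace ℝ (Fin n)) :
    pseudoInner ε u v = pseudoInner ε v u := by
  simp only [pseudoInner_apply, mul_comm]

theorem pseudoInner_nondegenerate {n : ℕ} {ε : Fin n → ℝ} (hε : ∀ i, ε i ≠ 0)
    (u : EuclideanSpace ℝ (Fin n)) (hu : ∀ v, pseudoInner ε u v = 0) : u = 0 := by
  ext i
  have h := hu (EuclideanSpace.single i 1)
  rw [pseudoInner_apply] at h
  simpa [hε i, Pi.single_apply] using h

theorem pseudoInner_toLp_mul {n : ℕ} {ε : Fin n → ℝ} (hε : ∀ i, ε i * ε i = 1)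
    (α : Fin n → ℝ) (v : EuclideanSpace ℝ (Fin n)) :
    pseudoInner ε (WithLp.toLp 2 fun i => ε i * α i) v = ∑ i, α i * v i := by
  rw [pseudoInner_apply]
  refine Finset.sum_congr rfl fun i _ => ?_
  change ε i * (ε i * α i * v i) = α i * v i
  linear_combination α i * v i * hε i

end SemiRiem

end

theorem corollary1p2 {n m : ℕ} (hn : 3 ≤ n)
    (ε : Fin n → ℝ) (hε : ∀ i, ε i = 1 ∨ ε i = -1)
    (α : Fin n → ℝ) (ε₀ : ℝ) (hε₀ : ∑ i, ε i * α i ^ 2 = ε₀) (hε₀_ne : ε₀ ≠ 0)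
    (ξ : EuclideanSpace ℝ (Fin n) → ℝ) (hξ : ∀ x, ξ x = ∑ i, α i * x i)
    {F : Type*} [TopologicalSpace F] [ChartedSpace (EuclideanSpace ℝ (Fin m)) F]
    [IsManifold (𝓡 m) ∞ F]
    (gF : SemiRiem.BilinField (𝓡 m) F) (hgF : SemiRiem.IsSemiRiemannian gF)
    (hRic : SemiRiem.IsRicciFlat gF)
    (φ : ℝ → ℝ) (hφ : ContDiff ℝ ∞ φ) (hφ_pos : ∀ t, 0 < φ t)
    (a b c k : ℝ) (f h ρ : ℝ → ℝ)
    (hf : ∀ t, f t = 1 / φ t)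
    (hh : ∀ t, h t = c + k * (∫ s in b..t, 1 / φ s ^ 2)
      - ((m : ℝ) + n - 2) *
        ∫ s in b..t, (∫ r in a..s, φ r * deriv (deriv φ) r) * (1 / φ s ^ 2))
    (hρ : ∀ t, ρ t = ε₀ * (φ t * deriv (deriv φ) t - ((m : ℝ) + n - 1) * deriv φ t ^ 2
      - k * (deriv φ t / φ t)
      + ((m : ℝ) + n - 2) * (deriv φ t / φ t) * ∫ r in a..t, φ r * deriv (deriv φ) r)) :
    SemiRiem.IsGradientRicciAlmostSoliton
      (SemiRiem.warpedProduct
        (SemiRiem.conformal (fun x => φ (ξ x)) (SemiRiem.pseudoEuclidean ε))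
        (fun x => f (ξ x)) gF)
      (fun p => h (ξ p.1)) (fun p => ρ (ξ p.1)) ∧
    SemiRiem.warpedProduct
        (SemiRiem.conformal (fun x => φ (ξ x)) (SemiRiem.pseudoEuclidean ε))
        (fun x => f (ξ x)) gF =
      SemiRiem.conformal (fun p : EuclideanSpace ℝ (Fin n) × F => φ (ξ p.1))
        (SemiRiem.warpedProduct (SemiRiem.pseudoEuclidean ε) (fun _ => 1) gF) := by
  have hε_ne : ∀ i, ε i ≠ 0 := fun i => by rcases hε i with h | h <;> simp [h]
  have hε_sq : ∀ i, ε i * ε i = 1 := fun i => by rcases hε i with h | h <;> simp [h]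
  let A : EuclideanSpace ℝ (Fin n) →L[ℝ] ℝ :=
    ∑ i, α i • (EuclideanSpace.proj i : EuclideanSpace ℝ (Fin n) →L[ℝ] ℝ)
  have hA : ∀ x, A x = ∑ i, α i * x i := fun x => by simp [A]
  obtain rfl : ξ = A := funext fun x => by rw [hξ, hA]
  have hAa : A (WithLp.toLp 2 fun i => ε i * α i) = ε₀ := by
    rw [hA, ← hε₀]
    refine Finset.sum_congr rfl fun i _ => ?_
    change α i * (ε i * α i) = _
    ring
  obtain ⟨hhs, hh1, hode⟩ := SemiRiem.contDiff_potential hφ hφ_pos hh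
  have hρ' : ∀ t, ρ t = ε₀ * (φ t * deriv (deriv φ) t - ((m : ℝ) + n - 1) * deriv φ t ^ 2
      - φ t * deriv φ t * deriv h t) := by
    intro t
    have := (hφ_pos t).ne'
    rw [hρ, hh1]
    field_simp
    ring
  have hρs : ContDiff ℝ ∞ ρ := by
    have h1 : ContDiff ℝ ∞ (deriv φ) := hφ.iterate_deriv 1
    have h2 : ContDiff ℝ ∞ (deriv (deriv φ)) := hφ.iterate_deriv 2
    have h3 : ContDiff ℝ ∞ (deriv h) := hhs.iterate_deriv 1
    rw [funext hρ']
    fun_prop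
  have hsmooth : ∀ {q : ℝ → ℝ}, ContDiff ℝ ∞ q → ContMDiff ((𝓡 n).prod (𝓡 m)) 𝓘(ℝ, ℝ) ∞
      fun p : EuclideanSpace ℝ (Fin n) × F => q (A p.1) := fun hq =>
    (hq.comp A.contDiff).contMDiff.comp contMDiff_fst
  refine ⟨⟨?_, hsmooth hhs, hsmooth hρs, ?_⟩, ?_⟩
  · exact hgF.warpedProduct_conformal (SemiRiem.pseudoInner_symm ε)
      (SemiRiem.pseudoInner_nondegenerate hε_ne) (hφ.comp A.contDiff) (fun x => hφ_pos (A x))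
      (fun x => hf (A x))
  · refine SemiRiem.ricci_add_hess_warpedProduct_conformal hgF hRic (SemiRiem.pseudoInner_symm ε)
      (SemiRiem.pseudoInner_nondegenerate hε_ne) (α := A)
      (fun v => (SemiRiem.pseudoInner_toLp_mul hε_sq α v).trans (hA v).symm)
      hφ hφ_pos hf hhs ?_ ?_
    · intro t
      rw [finrank_euclideanSpace_fin, finrank_euclideanSpace_fin, add_comm (n : ℝ)]
      exact hode t
    · intro t
      rw [finrank_euclideanSpace_fin, finrank_euclideanSpace_fin, add_comm (n : ℝ), hAa]
      exact hρ' t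
  · funext p
    refine ContinuousLinearMap.ext fun u => ContinuousLinearMap.ext fun v => ?_
    refine (SemiRiem.warpedProduct_conformal_const_apply (η := SemiRiem.pseudoInner ε)
      (fun x => hf (A x)) p u v).trans (congrArg (1 / φ (A p.1) ^ 2 * ·) ?_)
    refine (congrArg₂ (· + ·) rfl ?_).trans
      (SemiRiem.warpedProduct_apply (SemiRiem.pseudoEuclidean ε) (fun _ => 1) gF p u v).symm
    simp
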